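/- All rings are associative with a non-zero identity element. A module is distributive if its lattice of submodules is distributive, and uniserial if any two of its submodules are comparable with respect to inclusion. A ring $A$ is right (left) distributive, uniserial, Noetherian or Artinian if the module $A_A$ (respectively ${}_AA$) has the corresponding property, and the adjective without a side means that both $A_A$ and ${}_AA$ have it. A ring $A$ is centrally essential if for every non-zero $a\in A$ there are non-zero central elements $c,d\in A$ with $ac=d$. A commutative field counts as a Dedekind domain. Proposition 2.8. A ring $A$ is right distributive, left Noetherian and centrally essential if and only if $A\cong A_1\times\cdots\times A_n$ for some $n\ge 1$, where each $A_i$ is either a uniserial Artinian centrally essential ring or a commutative Dedekind domain. Moreover, every such product is a distributive Noetherian ring. -/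

import Mathlib

universe u v

/-- A module is distributive if the lattice of all its submodules is distributive. -/
def IsDistributiveModule (R : Type u) (M : Type v) [Ring R] [AddCommGroup M] [Module R M] : Prop :=
  ∀ X Y Z : Submodule R M, X ⊓ (Y ⊔ Z) = (X ⊓ Y) ⊔ (X ⊓ Z)

/-- A module is uniserial if any two of its submodules are comparable with respect to inclusion. -/
def IsUniserialModule (R : Type u) (M : Type v) [Ring R] [AddCommGroup M] [Module R M] : Prop :=
  ∀ X Y : Submodule R M, X ≤ Y ∨ Y ≤ X

/-- The left module of `A` over itself is `Module A A`; the right module is `Module Aᵐᵒᵖ A`. -/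
def IsLeftDistributiveRing (A : Type u) [Ring A] : Prop := IsDistributiveModule A A

def IsRightDistributiveRing (A : Type u) [Ring A] : Prop := IsDistributiveModule Aᵐᵒᵖ A

def IsLeftNoetherianRing (A : Type u) [Ring A] : Prop := IsNoetherian A A

def IsRightNoetherianRing (A : Type u) [Ring A] : Prop := IsNoetherian Aᵐᵒᵖ A

/-- Distributive on both sides. -/
def IsDistributiveRing (A : Type u) [Ring A] : Prop :=
  IsLeftDistributiveRing A ∧ IsRightDistributiveRing A

/-- Noetherian on both sides. -/
def IsTwoSidedNoetherianRing (A : Type u) [Ring A] : Prop :=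
  IsLeftNoetherianRing A ∧ IsRightNoetherianRing A

/-- Artinian on both sides. -/
def IsTwoSidedArtinianRing (A : Type u) [Ring A] : Prop :=
  IsArtinian A A ∧ IsArtinian Aᵐᵒᵖ A

/-- Uniserial on both sides. -/
def IsUniserialRing (A : Type u) [Ring A] : Prop :=
  IsUniserialModule A A ∧ IsUniserialModule Aᵐᵒᵖ A

/-- For every non-zero `a` there are non-zero central elements `c`, `d` with `a * c = d`. -/
def IsCentrallyEssential (A : Type u) [Ring A] : Prop :=
  ∀ a : A, a ≠ 0 → ∃ c ∈ Subring.center A, ∃ d ∈ Subring.center A, c ≠ 0 ∧ d ≠ 0 ∧ a * c = d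

/-- The multiplication of `A` is commutative and the resulting commutative ring is a Dedekind
domain (fields are allowed). -/
def IsCommDedekindDomain (A : Type u) [Ring A] : Prop :=
  ∃ h : ∀ a b : A, a * b = b * a,
    letI : CommRing A := { (inferInstance : Ring A) with mul_comm := h }
    IsDedekindDomain A

/-- `A` is isomorphic to a product of finitely many non-zero rings, at least one, each of which is
a uniserial Artinian centrally essential ring or a commutative Dedekind domain. -/
def IsProductOfUniserialArtinianOrDedekind (A : Type u) [Ring A] : Prop :=
  ∃ (n : ℕ) (B : Fin n → Type u) (_ : ∀ i, Ring (B i)),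
    0 < n ∧
    (∀ i, Nontrivial (B i) ∧
      ((IsUniserialRing (B i) ∧ IsTwoSidedArtinianRing (B i) ∧ IsCentrallyEssential (B i)) ∨
        IsCommDedekindDomain (B i))) ∧
    Nonempty (A ≃+* (∀ i, B i))

/-! ### Distributivity in terms of elements -/

section Distributive

/-! On the right side, distributivity means that for all `x`, `y` there are `a + b = 1` with `x * a
∈ yA` and `y * b ∈ xA`. Central essentiality makes every idempotent central, so the left Noetherian
condition splits the ring into finitely many indecomposable factors.

In such a factor `A` every central element is nilpotent or regular
(`isNilpotent_or_regular_of_mem_center`). This yields a nil ideal `N` with commutative reduced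
quotient `R` (`exists_surjective_isReduced`), and the same dichotomy in `R` makes it a domain. If `N
= 0`, then `A` is a commutative Noetherian distributive domain, hence Dedekind. If `N ≠ 0`,
distributivity makes the nonzero finitely generated `R`-module `N/N²` divisible, so `R` is a field
and `A` is local (`isField_and_exists_mem_ker`). An `x ∈ N` that is not a product of two elements of
`N` generates `N` as a right ideal. Central essentiality gives `xA ⊆ Ax`, so `N = xA = Ax` with `x`
nilpotent, and the powers of `x` generate all one-sided ideals.

Conversely, uniserial modules are distributive, Artinian rings are Noetherian, Dedekind domains
satisfy the element criterion by cancelling ideals, and all the properties pass to finite products.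
-/

theorem isDistributiveModule_iff_exists_add_eq_one {R : Type u} {M : Type v} [Ring R]
    [AddCommGroup M] [Module R M] :
    IsDistributiveModule R M ↔
      ∀ x y : M, ∃ a b : R, a + b = 1 ∧ (∃ r : R, a • x = r • y) ∧ ∃ r : R, b • y = r • x := by
  constructor
  · intro h x y
    -- Only the cyclic submodules of `x + y`, `y` and `x` are needed: `x + y` splits into two of its
    -- own multiples, one in `Ry` and one in `Rx`.
    have key := h (Submodule.span R {x + y}) (Submodule.span R {y}) (Submodule.span R {x})
    have hm : x + y ∈ Submodule.span R {x + y} ⊓ (Submodule.span R {y} ⊔ Submodule.span R {x}) :=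
      ⟨Submodule.mem_span_singleton_self _, by
        rw [add_comm]
        exact Submodule.add_mem_sup (Submodule.mem_span_singleton_self _)
          (Submodule.mem_span_singleton_self _)⟩
    rw [key] at hm
    obtain ⟨p, hp, q, hq, hpq⟩ := Submodule.mem_sup.1 hm
    obtain ⟨a, ha⟩ := Submodule.mem_span_singleton.1 hp.1
    obtain ⟨s, hs⟩ := Submodule.mem_span_singleton.1 hp.2
    obtain ⟨t, ht⟩ := Submodule.mem_span_singleton.1 hq.2
    refine ⟨a, 1 - a, by abel, ⟨s - a, ?_⟩, ⟨t - (1 - a), ?_⟩⟩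
    · rw [sub_smul, hs, ← ha, smul_add]; abel
    · have : (1 - a) • (x + y) = q := by rw [sub_smul, one_smul, ha, ← hpq]; abel
      rw [sub_smul t, ht, ← this, smul_add]; abel
  · intro h X Y Z
    refine le_antisymm ?_ (sup_le (inf_le_inf_left _ le_sup_left) (inf_le_inf_left _ le_sup_right))
    rintro w ⟨hw, hYZ⟩
    obtain ⟨y, hy, z, hz, rfl⟩ := Submodule.mem_sup.1 hYZ
    obtain ⟨a, b, hab, ⟨r, hr⟩, ⟨s, hs⟩⟩ := h y z
    have e : y + z = b • (y + z) + a • (y + z) := by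
      rw [← add_smul, add_comm b, hab, one_smul]
    rw [e]
    refine Submodule.add_mem_sup ⟨X.smul_mem _ hw, ?_⟩ ⟨X.smul_mem _ hw, ?_⟩
    · rw [smul_add, hs]; exact Y.add_mem (Y.smul_mem _ hy) (Y.smul_mem _ hy)
    · rw [smul_add, hr]; exact Z.add_mem (Z.smul_mem _ hz) (Z.smul_mem _ hz)

theorem IsUniserialModule.isDistributiveModule {R : Type u} {M : Type v} [Ring R]
    [AddCommGroup M] [Module R M] (h : IsUniserialModule R M) : IsDistributiveModule R M := by
  intro X Y Z
  rcases h Y Z with h | h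
  · rw [sup_eq_right.2 h, sup_eq_right.2 (inf_le_inf_left _ h)]
  · rw [sup_eq_left.2 h, sup_eq_left.2 (inf_le_inf_left _ h)]

theorem isRightDistributiveRing_iff {A : Type u} [Ring A] :
    IsRightDistributiveRing A ↔
      ∀ x y : A, ∃ a b : A, a + b = 1 ∧ (∃ r, x * a = y * r) ∧ ∃ r, y * b = x * r := by
  rw [IsRightDistributiveRing, isDistributiveModule_iff_exists_add_eq_one]
  refine forall₂_congr fun x y => ⟨?_, ?_⟩
  · rintro ⟨a, b, hab, ⟨r, hr⟩, ⟨s, hs⟩⟩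
    exact ⟨a.unop, b.unop, congrArg MulOpposite.unop hab, ⟨r.unop, hr⟩, ⟨s.unop, hs⟩⟩
  · rintro ⟨a, b, hab, ⟨r, hr⟩, ⟨s, hs⟩⟩
    exact ⟨.op a, .op b, congrArg MulOpposite.op hab, ⟨.op r, hr⟩, ⟨.op s, hs⟩⟩

theorem isLeftDistributiveRing_iff {A : Type u} [Ring A] :
    IsLeftDistributiveRing A ↔
      ∀ x y : A, ∃ a b : A, a + b = 1 ∧ (∃ r, a * x = r * y) ∧ ∃ r, b * y = r * x :=
  isDistributiveModule_iff_exists_add_eq_one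

theorem IsRightDistributiveRing.of_surjective {A : Type u} {B : Type v} [Ring A] [Ring B]
    (h : IsRightDistributiveRing A) (f : A →+* B) (hf : Function.Surjective f) :
    IsRightDistributiveRing B := by
  rw [isRightDistributiveRing_iff] at h ⊢
  intro x y
  obtain ⟨x, rfl⟩ := hf x
  obtain ⟨y, rfl⟩ := hf y
  obtain ⟨a, b, hab, ⟨r, hr⟩, ⟨s, hs⟩⟩ := h x y
  exact ⟨f a, f b, by rw [← map_add, hab, map_one], ⟨f r, by simp only [← map_mul, hr]⟩,
    ⟨f s, by simp only [← map_mul, hs]⟩⟩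

theorem IsLeftDistributiveRing.of_surjective {A : Type u} {B : Type v} [Ring A] [Ring B]
    (h : IsLeftDistributiveRing A) (f : A →+* B) (hf : Function.Surjective f) :
    IsLeftDistributiveRing B := by
  rw [isLeftDistributiveRing_iff] at h ⊢
  intro x y
  obtain ⟨x, rfl⟩ := hf x
  obtain ⟨y, rfl⟩ := hf y
  obtain ⟨a, b, hab, ⟨r, hr⟩, ⟨s, hs⟩⟩ := h x y
  exact ⟨f a, f b, by rw [← map_add, hab, map_one], ⟨f r, by simp only [← map_mul, hr]⟩,
    ⟨f s, by simp only [← map_mul, hs]⟩⟩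

theorem IsRightDistributiveRing.pi {ι : Type*} {B : ι → Type v} [∀ i, Ring (B i)]
    (h : ∀ i, IsRightDistributiveRing (B i)) : IsRightDistributiveRing (∀ i, B i) := by
  simp only [isRightDistributiveRing_iff] at h ⊢
  intro x y
  choose a b hab h1 s hs using fun i => h i (x i) (y i)
  choose r hr using h1
  exact ⟨a, b, funext hab, ⟨r, funext hr⟩, ⟨s, funext hs⟩⟩

theorem IsLeftDistributiveRing.pi {ι : Type*} {B : ι → Type v} [∀ i, Ring (B i)]
    (h : ∀ i, IsLeftDistributiveRing (B i)) : IsLeftDistributiveRing (∀ i, B i) := by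
  simp only [isLeftDistributiveRing_iff] at h ⊢
  intro x y
  choose a b hab h1 s hs using fun i => h i (x i) (y i)
  choose r hr using h1
  exact ⟨a, b, funext hab, ⟨r, funext hr⟩, ⟨s, funext hs⟩⟩

end Distributive

/-! ### Chain conditions on both sides -/

section Noetherian

theorem isRightNoetherianRing_iff {A : Type u} [Ring A] :
    IsRightNoetherianRing A ↔ IsNoetherianRing Aᵐᵒᵖ :=
  (MulOpposite.opLinearEquiv (M := A) Aᵐᵒᵖ).isNoetherian_iff

theorem isArtinian_mulOpposite_iff {A : Type u} [Ring A] :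
    IsArtinian Aᵐᵒᵖ A ↔ IsArtinianRing Aᵐᵒᵖ :=
  (MulOpposite.opLinearEquiv (M := A) Aᵐᵒᵖ).isArtinian_iff

theorem IsTwoSidedArtinianRing.isTwoSidedNoetherianRing {A : Type u} [Ring A]
    (h : IsTwoSidedArtinianRing A) : IsTwoSidedNoetherianRing A := by
  have h1 : IsArtinianRing A := h.1
  have h2 : IsArtinianRing Aᵐᵒᵖ := isArtinian_mulOpposite_iff.1 h.2
  exact ⟨(inferInstance : IsNoetherianRing A), isRightNoetherianRing_iff.2 inferInstance⟩

theorem IsTwoSidedNoetherianRing.of_ringEquiv {A : Type u} {B : Type v} [Ring A] [Ring B]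
    (h : IsTwoSidedNoetherianRing A) (f : A ≃+* B) : IsTwoSidedNoetherianRing B := by
  have h1 : IsNoetherianRing A := h.1
  have h2 : IsNoetherianRing Aᵐᵒᵖ := isRightNoetherianRing_iff.1 h.2
  exact ⟨isNoetherianRing_of_ringEquiv A f,
    isRightNoetherianRing_iff.2 (isNoetherianRing_of_ringEquiv _ f.op)⟩

theorem IsTwoSidedNoetherianRing.pi {ι : Type*} [Finite ι] {B : ι → Type v} [∀ i, Ring (B i)]
    (h : ∀ i, IsTwoSidedNoetherianRing (B i)) : IsTwoSidedNoetherianRing (∀ i, B i) := by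
  have h1 : ∀ i, IsNoetherianRing (B i) := fun i => (h i).1
  have h2 : ∀ i, IsNoetherianRing (B i)ᵐᵒᵖ := fun i => isRightNoetherianRing_iff.1 (h i).2
  refine ⟨(inferInstance : IsNoetherianRing (∀ i, B i)), isRightNoetherianRing_iff.2 ?_⟩
  let e : (∀ i, (B i)ᵐᵒᵖ) ≃+* (∀ i, B i)ᵐᵒᵖ :=
    { toFun := fun g => .op fun i => (g i).unop
      invFun := fun g i => .op (g.unop i)
      left_inv := fun _ => rfl
      right_inv := fun _ => rfl
      map_mul' := fun _ _ => rfl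
      map_add' := fun _ _ => rfl }
  exact isNoetherianRing_of_ringEquiv _ e

end Noetherian

/-! ### Central essentiality and idempotents -/

section CentrallyEssential

theorem IsCentrallyEssential.of_ringEquiv {A : Type u} {B : Type v} [Ring A] [Ring B]
    (h : IsCentrallyEssential A) (f : A ≃+* B) : IsCentrallyEssential B := by
  have hc : ∀ c ∈ Subring.center A, f c ∈ Subring.center B := fun c hc =>
    Subring.mem_center_iff.2 fun g => by
      obtain ⟨g, rfl⟩ := f.surjective g
      rw [← map_mul, ← map_mul, Subring.mem_center_iff.1 hc]
  intro b hb
  obtain ⟨a, rfl⟩ := f.surjective b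
  obtain ⟨c, hcc, d, hd, hc0, hd0, e⟩ := h a fun h => hb (by rw [h, map_zero])
  exact ⟨f c, hc _ hcc, f d, hc _ hd, by simpa using hc0, by simpa using hd0, by rw [← map_mul, e]⟩

theorem IsCentrallyEssential.pi {ι : Type*} {B : ι → Type v} [∀ i, Ring (B i)]
    (h : ∀ i, IsCentrallyEssential (B i)) : IsCentrallyEssential (∀ i, B i) := by
  classical
  intro a ha
  obtain ⟨i, hi⟩ := Function.ne_iff.1 ha
  obtain ⟨c, hcc, d, hdc, hc0, hd0, e⟩ := h i (a i) hi
  have hs : ∀ z ∈ Subring.center (B i), Pi.single i z ∈ Subring.center (∀ i, B i) := fun z hz =>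
    Subring.mem_center_iff.2 fun g => by
      rw [← Pi.single_mul_right, ← Pi.single_mul_left, Subring.mem_center_iff.1 hz]
  exact ⟨Pi.single i c, hs _ hcc, Pi.single i d, hs _ hdc, by simpa using hc0, by simpa using hd0,
    by rw [← Pi.single_mul_right, e]⟩

theorem isCentrallyEssential_of_comm {A : Type u} [Ring A] [Nontrivial A]
    (h : ∀ a b : A, a * b = b * a) : IsCentrallyEssential A := fun a ha =>
  ⟨1, one_mem _, a, Subring.mem_center_iff.2 fun _ => h _ _, one_ne_zero, ha, mul_one a⟩

theorem IsCentrallyEssential.exists_mul_mem_center {A : Type u} [Ring A]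
    (h : IsCentrallyEssential A) {a : A} (ha : a ≠ 0) :
    ∃ c ∈ Subring.center A, a * c ∈ Subring.center A ∧ a * c ≠ 0 := by
  obtain ⟨c, hc, d, hd, -, hd0, rfl⟩ := h a ha
  exact ⟨c, hc, hd, hd0⟩

theorem IsCentrallyEssential.mem_center_of_isIdempotentElem {A : Type u} [Ring A]
    (h : IsCentrallyEssential A) {e : A} (he : IsIdempotentElem e) : e ∈ Subring.center A := by
  -- If `a = e * x * (1 - e)` had a nonzero central multiple `a * c` with `c` central, then `a * c =
  -- e * (a * c) = (a * c) * e = a * e * c = 0`.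
  have key : ∀ e : A, IsIdempotentElem e → ∀ x, e * x * (1 - e) = 0 := by
    intro e he x
    by_contra ha
    obtain ⟨c, hc, hd, hd0⟩ := h.exists_mul_mem_center ha
    apply hd0
    have h1 : e * (e * x * (1 - e) * c) = e * x * (1 - e) * c := by
      simp only [← mul_assoc, he.eq]
    rw [← h1, Subring.mem_center_iff.1 hd e, mul_assoc _ c e, ← Subring.mem_center_iff.1 hc e,
      ← mul_assoc, mul_assoc _ _ e, he.one_sub_mul_self, mul_zero, zero_mul]
  rw [Subring.mem_center_iff]
  intro x
  have h1 := key e he x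
  have h2 := key (1 - e) he.one_sub x
  rw [mul_sub, mul_one, sub_eq_zero] at h1
  rw [sub_sub_cancel, sub_mul, sub_mul, one_mul, sub_eq_zero] at h2
  rw [h2, ← h1]

end CentrallyEssential

/-! ### Dedekind domains and the element criterion -/

section Dedekind

/-- With `I = (x) + (y)`, write `(x) = IX` and `(y) = IY`. Cancelling `I` gives `X + Y = 1`, and
`(x)Y = IXY = (y)X`, so `a` is taken in `Y` and `b` in `X`. -/
theorem IsDedekindDomain.exists_add_eq_one {R : Type u} [CommRing R] [IsDedekindDomain R]
    (x y : R) : ∃ a b : R, a + b = 1 ∧ (∃ r, x * a = y * r) ∧ ∃ r, y * b = x * r := by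
  by_cases hx : x = 0
  · exact ⟨1, 0, add_zero 1, ⟨0, by simp [hx]⟩, ⟨0, by simp⟩⟩
  obtain ⟨X, hX⟩ := Ideal.dvd_iff_le.2 (le_sup_left : Ideal.span {x} ≤ Ideal.span {x} ⊔ Ideal.span {y})
  obtain ⟨Y, hY⟩ := Ideal.dvd_iff_le.2 (le_sup_right : Ideal.span {y} ≤ Ideal.span {x} ⊔ Ideal.span {y})
  set I := Ideal.span {x} ⊔ Ideal.span {y} with hI
  have hI0 : I ≠ 0 := by
    intro h0
    apply hx
    have : x ∈ I := Ideal.mem_sup_left (Ideal.mem_span_singleton_self x)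
    rwa [h0] at this
  have hXY : X ⊔ Y = 1 := by
    apply mul_left_cancel₀ hI0
    rw [Ideal.mul_sup, ← hX, ← hY, mul_one]
  have h1 : (1 : R) ∈ X ⊔ Y := by rw [hXY, Ideal.one_eq_top]; trivial
  obtain ⟨b, hb, a, ha, hab⟩ := Submodule.mem_sup.1 h1
  refine ⟨a, b, by rw [add_comm, hab], ?_, ?_⟩
  · have h2 : x * a ∈ Ideal.span {x} * Y := Ideal.mul_mem_mul (Ideal.mem_span_singleton_self x) ha
    rw [hX, mul_right_comm, ← hY] at h2
    obtain ⟨r, hr⟩ := Ideal.mem_span_singleton'.1 (Ideal.mul_le_left h2)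
    exact ⟨r, by rw [← hr, mul_comm]⟩
  · have h2 : y * b ∈ Ideal.span {y} * X := Ideal.mul_mem_mul (Ideal.mem_span_singleton_self y) hb
    rw [hY, mul_right_comm, ← hX] at h2
    obtain ⟨r, hr⟩ := Ideal.mem_span_singleton'.1 (Ideal.mul_le_left h2)
    exact ⟨r, by rw [← hr, mul_comm]⟩

/-- At a prime `P` one of `a`, `b` lies outside `P` and becomes invertible, so divisibility is total
in the localization. A Noetherian valuation ring that is not a field is a discrete valuation ring.
-/
theorem isDedekindDomain_of_exists_add_eq_one {R : Type u} [CommRing R] [IsDomain R]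
    [IsNoetherianRing R]
    (h : ∀ x y : R, ∃ a b : R, a + b = 1 ∧ (∃ r, x * a = y * r) ∧ ∃ r, y * b = x * r) :
    IsDedekindDomain R := by
  suffices IsDedekindDomainDvr R from inferInstance
  refine ⟨fun P hP hPp => ?_⟩
  have hv : ValuationRing (Localization.AtPrime P) := by
    rw [ValuationRing.iff_dvd_total]
    refine ⟨fun x y => ?_⟩
    obtain ⟨x, s, rfl⟩ := IsLocalization.exists_mk'_eq P.primeCompl x
    obtain ⟨y, t, rfl⟩ := IsLocalization.exists_mk'_eq P.primeCompl y
    have key : ∀ (x y a r : R) (s t : P.primeCompl), a ∉ P → x * a = y * r →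
        IsLocalization.mk' (Localization.AtPrime P) y t ∣
          IsLocalization.mk' (Localization.AtPrime P) x s := by
      intro x y a r s t ha hr
      refine ⟨IsLocalization.mk' _ (r * t) (s * ⟨a, ha⟩), ?_⟩
      rw [← IsLocalization.mk'_mul, IsLocalization.mk'_eq_iff_eq]
      congr 1
      simp only [Submonoid.coe_mul]
      linear_combination (t * s : R) * hr
    obtain ⟨a, b, hab, ⟨r, hr⟩, ⟨q, hq⟩⟩ := h x y
    by_cases ha : a ∈ P
    · have hb : b ∉ P := fun hb => hPp.ne_top
        ((Ideal.eq_top_iff_one P).2 (hab ▸ P.add_mem ha hb))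
      exact Or.inl (key y x b q t s hb hq)
    · exact Or.inr (key x y a r s t ha hr)
  have : IsNoetherianRing (Localization.AtPrime P) :=
    IsLocalization.isNoetherianRing P.primeCompl _ inferInstance
  have : IsPrincipalIdealRing (Localization.AtPrime P) :=
    ((IsBezout.TFAE (R := Localization.AtPrime P)).out 0 1).1 this
  exact { not_a_field' := fun hm => IsLocalization.AtPrime.not_isField R hP (Localization.AtPrime P)
            (IsLocalRing.isField_iff_maximalIdeal_eq.2 hm) }

end Dedekind

/-! ### A Fitting dichotomy for central elements -/

section Fitting

/-- The annihilators of the powers of `d` stabilize at some `K n`. Distributivity gives this ideal a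
right identity lying in it, which is an idempotent and hence 0 or 1: the first means `K n = 0`, the
second `d ^ n = 0`. -/
theorem isNilpotent_or_regular_of_mem_center {A : Type u} [Ring A] [IsNoetherianRing A]
    (hD : IsRightDistributiveRing A)
    (hI : ∀ e : A, IsIdempotentElem e → e = 0 ∨ e = 1) {d : A} (hd : d ∈ Subring.center A) :
    IsNilpotent d ∨ ∀ x, x * d = 0 → x = 0 := by
  rw [isRightDistributiveRing_iff] at hD
  rw [Subring.mem_center_iff] at hd
  have hdn : ∀ n g, g * d ^ n = d ^ n * g := fun n g => (Commute.pow_right (hd g) n)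
  let K : ℕ →o Ideal A :=
    { toFun := fun n => LinearMap.ker (LinearMap.toSpanSingleton A A (d ^ n))
      monotone' := by
        intro m n hmn x hx
        obtain ⟨k, rfl⟩ := Nat.exists_eq_add_of_le hmn
        simp only [LinearMap.mem_ker, LinearMap.toSpanSingleton_apply, smul_eq_mul] at hx ⊢
        rw [pow_add, ← mul_assoc, hx, zero_mul] }
  have hK : ∀ n x, x ∈ K n ↔ x * d ^ n = 0 := fun n x => Iff.rfl
  obtain ⟨n, hn⟩ := monotone_stabilizes_iff_noetherian.2 ‹IsNoetherianRing A› K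
  have hK2 : ∀ x, x * d ^ n * d ^ n = 0 → x * d ^ n = 0 := by
    intro x hx
    rw [← hK, hn (n + n) (by omega), hK, pow_add, ← mul_assoc, hx]
  -- Applied to `x` and `d ^ n`, the criterion puts `x * a` in `K n` and in the multiples of `d ^
  -- n`, which meet in zero by `hK2`.
  have step : ∀ x ∈ K n, ∃ b ∈ K n, x * b = x := by
    intro x hx
    rw [hK] at hx
    obtain ⟨a, b, hab, ⟨r, hr⟩, ⟨s, hs⟩⟩ := hD x (d ^ n)
    have h1 : x * a = 0 := by
      rw [hr, ← hdn]
      apply hK2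
      rw [hdn n r, ← hr, mul_assoc, hdn, ← mul_assoc, hx, zero_mul]
    refine ⟨b, ?_, by rw [← add_zero (x * b), ← h1, ← mul_add, add_comm, hab, mul_one]⟩
    rw [hK]
    apply hK2
    rw [hdn n b, hs, mul_assoc, hdn, ← mul_assoc, hx, zero_mul]
  obtain ⟨s, hs⟩ : (K n).FG := IsNoetherian.noetherian _
  have fin : ∀ t : Finset A, (∀ x ∈ t, x ∈ K n) → ∃ b ∈ K n, ∀ x ∈ t, x * b = x := by
    classical
    intro t
    induction t using Finset.induction_on with
    | empty => exact fun _ => ⟨0, zero_mem _, by simp⟩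
    | insert y t _ ih =>
      intro ht
      obtain ⟨b, hb, hbt⟩ := ih fun x hx => ht x (Finset.mem_insert_of_mem hx)
      have hyb : y - y * b ∈ K n := sub_mem (ht y (Finset.mem_insert_self _ _))
        ((K n).mul_mem_left _ hb)
      obtain ⟨c, hc, hyc⟩ := step _ hyb
      -- Chosen so that `1 - (b + c - b * c) = (1 - b) * (1 - c)`: the first factor kills the old
      -- elements, and the product kills `y`.
      refine ⟨b + c - b * c, sub_mem (add_mem hb hc) ((K n).mul_mem_left _ hc), fun x hx => ?_⟩
      rcases Finset.mem_insert.1 hx with rfl | hx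
      · rw [sub_mul, mul_assoc] at hyc
        rw [mul_sub, mul_add, add_sub_assoc, hyc]; abel
      · rw [mul_sub, mul_add, ← mul_assoc, hbt x hx]; abel
  obtain ⟨b, hb, hbs⟩ := fin s fun x hx => hs ▸ Submodule.subset_span hx
  have hbK : ∀ x ∈ K n, x * b = x := by
    intro x hx
    rw [← hs] at hx
    induction hx using Submodule.span_induction with
    | mem x hx => exact hbs x hx
    | zero => exact zero_mul b
    | add x y _ _ hx hy => rw [add_mul, hx, hy]
    | smul a x _ hx => rw [smul_eq_mul, mul_assoc, hx]
  rcases hI b (hbK b hb) with rfl | rfl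
  · right
    intro x hx
    have h1 : x ∈ K (n + 1) := by rw [hK, pow_succ', ← mul_assoc, hx, zero_mul]
    rw [← hn (n + 1) (by omega)] at h1
    rw [← hbK x h1, mul_zero]
  · left
    exact ⟨n, by simpa [hK] using hb⟩

end Fitting

/-! ### The dichotomy in reduced commutative rings -/

section Commutative

/-- In the commutative case the Fitting dichotomy says that a reduced ring is a domain. -/
theorem isDomain_of_isReduced {R : Type u} [CommRing R] [Nontrivial R] [IsNoetherianRing R]
    [IsReduced R] (hD : IsRightDistributiveRing R)
    (hI : ∀ e : R, IsIdempotentElem e → e = 0 ∨ e = 1) : IsDomain R := by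
  have : NoZeroDivisors R := ⟨fun {a b} hab => by
    rcases isNilpotent_or_regular_of_mem_center hD hI
      (d := b) (Subring.mem_center_iff.2 fun g => mul_comm _ _) with h | h
    · exact Or.inr h.eq_zero
    · exact Or.inl (h a hab)⟩
  exact NoZeroDivisors.to_isDomain R

end Commutative

/-! ### A nil ideal with commutative quotient -/

section CommutativeModuloNil

/-- Modulo the annihilator of the elements killed by all central nilpotents the ring becomes
commutative, and this annihilator is nilpotent. -/
theorem exists_surjective_isReduced {A : Type u} [Ring A] [IsNoetherianRing A]
    (hD : IsRightDistributiveRing A) (hC : IsCentrallyEssential A)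
    (hI : ∀ e : A, IsIdempotentElem e → e = 0 ∨ e = 1) :
    ∃ (R : Type u) (_ : CommRing R) (π : A →+* R), Function.Surjective π ∧ IsReduced R ∧
      ∀ a, π a = 0 → IsNilpotent a := by
  classical
  let S : Set A := {z | z ∈ Subring.center A ∧ IsNilpotent z}
  let E : Ideal A :=
    { carrier := {y | ∀ z ∈ S, y * z = 0}
      add_mem' := fun {a b} ha hb z hz => by rw [add_mul, ha z hz, hb z hz, add_zero]
      zero_mem' := fun z _ => zero_mul z
      smul_mem' := fun c y hy z hz => by rw [smul_eq_mul, mul_assoc, hy z hz, mul_zero] }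
  -- A central `c` with `y * c` central and nonzero is not nilpotent, since `y` kills central
  -- nilpotents. So `c` is regular and can be cancelled from `(g * y - y * g) * c = 0`.
  have hEc : ∀ y ∈ E, y ∈ Subring.center A := by
    intro y hy
    by_cases hy0 : y = 0
    · rw [hy0]; exact zero_mem _
    obtain ⟨c, hc, hyc, hyc0⟩ := hC.exists_mul_mem_center hy0
    have hreg : ∀ x, x * c = 0 → x = 0 :=
      (isNilpotent_or_regular_of_mem_center hD hI hc).resolve_left fun h => hyc0 (hy c ⟨hc, h⟩)
    rw [Subring.mem_center_iff] at hc hyc ⊢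
    intro g
    rw [← sub_eq_zero]
    apply hreg
    rw [sub_mul, mul_assoc, hyc, mul_assoc, mul_assoc, hc, sub_self]
  let Q : Ideal A :=
    { carrier := {q | ∀ y ∈ E, q * y = 0}
      add_mem' := fun {a b} ha hb z hz => by rw [add_mul, ha z hz, hb z hz, add_zero]
      zero_mem' := fun z _ => zero_mul z
      smul_mem' := fun c y hy z hz => by rw [smul_eq_mul, mul_assoc, hy z hz, mul_zero] }
  have hQ2 : Q.IsTwoSided := ⟨fun {a} b ha y hy => by
    rw [mul_assoc]; exact ha _ (E.mul_mem_left _ hy)⟩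
  have hcomm : ∀ x y : A, x * y - y * x ∈ Q := by
    intro x y e he
    have h1 := Subring.mem_center_iff.1 (hEc _ (E.mul_mem_left y he)) x
    have h2 := Subring.mem_center_iff.1 (hEc _ he) x
    rw [sub_mul, mul_assoc, h1, mul_assoc, mul_assoc, h2, sub_self]
  have hnil : ∀ q ∈ Q, IsNilpotent q := by
    obtain ⟨s, hsS, hs⟩ := (Submodule.fg_span_iff_fg_span_finset_subset (R := A) S).1
      (IsNoetherian.noetherian _)
    -- The centre need not be Noetherian, so finitely many generators are taken from the left ideal
    -- `A S`. They are nilpotent and generate a nilpotent ideal of the centre.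
    let n : Ideal (Subring.center A) := Ideal.span (Subtype.val ⁻¹' (s : Set A))
    have hn : IsNilpotent n := by
      refine (Ideal.FG.isNilpotent_iff_le_nilradical ?_).2 ?_
      · exact Submodule.fg_span (s.finite_toSet.preimage Subtype.val_injective.injOn)
      · refine Ideal.span_le.2 fun z hz => ?_
        obtain ⟨k, hk⟩ := (hsS hz).2
        exact ⟨k, Subtype.ext hk⟩
    obtain ⟨K, hK⟩ := hn
    have hyE : ∀ y, (∀ w ∈ n, y * (w : A) = 0) → y ∈ E := by
      intro y hy z hz
      have h1 : z ∈ Submodule.span A (s : Set A) := by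
        rw [← hs]; exact Submodule.subset_span hz
      have h2 : ∀ a, y * a * z = 0 := by
        clear hz
        induction h1 using Submodule.span_induction with
        | mem x hx =>
          intro a
          have hxc := (hsS hx).1
          have h3 := hy ⟨x, hxc⟩ (Ideal.subset_span hx)
          rw [mul_assoc, Subring.mem_center_iff.1 hxc, ← mul_assoc]
          simp only at h3
          rw [h3, zero_mul]
        | zero => simp
        | add x z _ _ hx hz => intro a; rw [mul_add, hx, hz, add_zero]
        | smul b x _ hx => intro a; rw [smul_eq_mul, ← mul_assoc, mul_assoc y, hx]
      simpa using h2 1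
    -- If `n ^ (k + 1)` kills `y`, then `y * n ^ k` lies in `E`, which `q` kills. Each factor `q`
    -- thus lowers the exponent by one, starting from `n ^ K = 0`.
    have step : ∀ (k : ℕ) (q y : A), q ∈ Q → (∀ w ∈ n ^ (k + 1), y * (w : A) = 0) →
        ∀ w ∈ n ^ k, q * y * (w : A) = 0 := by
      intro k
      induction k with
      | zero =>
        intro q y hq hy w _
        rw [zero_add, pow_one] at hy
        rw [hq y (hyE y hy), zero_mul]
      | succ k ih =>
        intro q y hq hy w hw
        rw [pow_succ'] at hw
        refine Submodule.mul_induction_on hw (fun z hz w hw => ?_) fun a b ha hb => ?_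
        · rw [Subring.coe_mul, ← mul_assoc, mul_assoc q]
          refine ih q (y * z) hq (fun v hv => ?_) w hw
          rw [mul_assoc, ← Subring.coe_mul]
          exact hy _ (by rw [pow_succ']; exact Ideal.mul_mem_mul hz hv)
        · rw [Subring.coe_add, mul_add, ha, hb, add_zero]
    intro q hq
    have hpow : ∀ j m : ℕ, m + j = K → ∀ w ∈ n ^ m, q ^ j * (w : A) = 0 := by
      intro j
      induction j with
      | zero =>
        intro m hm w hw
        rw [add_zero] at hm
        rw [hm, hK] at hw
        rw [show w = 0 from hw]; simp
      | succ j ih =>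
        intro m hm w hw
        rw [pow_succ']
        exact step m q _ hq (ih (m + 1) (by omega)) w hw
    exact ⟨K, by simpa using hpow K 0 (by simp) 1 (by simp)⟩
  let _ : CommRing (A ⧸ Q) :=
    { (inferInstance : Ring (A ⧸ Q)) with
      mul_comm := fun x y => by
        obtain ⟨x, rfl⟩ := Ideal.Quotient.mk_surjective x
        obtain ⟨y, rfl⟩ := Ideal.Quotient.mk_surjective y
        exact Ideal.Quotient.eq.2 (hcomm x y) }
  refine ⟨(A ⧸ Q) ⧸ nilradical (A ⧸ Q), inferInstance,
    (Ideal.Quotient.mk (nilradical (A ⧸ Q))).comp (Ideal.Quotient.mk Q),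
    Ideal.Quotient.mk_surjective.comp Ideal.Quotient.mk_surjective,
    (Ideal.isRadical_iff_quotient_reduced _).1 (Ideal.radical_isRadical _), fun a ha => ?_⟩
  obtain ⟨k, hk⟩ := (Ideal.Quotient.eq_zero_iff_mem.1 ha : Ideal.Quotient.mk Q a ∈ nilradical _)
  have h1 : a ^ k ∈ Q := Ideal.Quotient.eq_zero_iff_mem.1 (by rw [map_pow]; exact hk)
  obtain ⟨m, hm⟩ := hnil _ h1
  exact ⟨k * m, by rw [pow_mul, hm]⟩

end CommutativeModuloNil

/-! ### The quotient is a field when the nil ideal is nonzero -/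

section ResidueField

/-- Since `xM = M`, Nakayama gives `r ≡ 1` modulo `x` annihilating `M`. Divisibility forces `r = 0`,
so `x` is a unit. -/
theorem isField_of_divisible {R : Type u} {M : Type v} [CommRing R] [Nontrivial R]
    [AddCommGroup M] [Module R M] [Module.Finite R M] [Nontrivial M]
    (h : ∀ r : R, r ≠ 0 → ∀ m : M, ∃ m', r • m' = m) : IsField R := by
  refine ⟨exists_pair_ne R, mul_comm, fun {x} hx => ?_⟩
  obtain ⟨r, hr, hr0⟩ := Submodule.exists_sub_one_mem_and_smul_eq_zero_of_fg_of_le_smul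
    (Ideal.span {x}) (⊤ : Submodule R M) Module.Finite.fg_top (fun m _ => by
      obtain ⟨m', rfl⟩ := h x hx m
      exact Submodule.smul_mem_smul (Ideal.mem_span_singleton_self x) trivial)
  have : r = 0 := by
    by_contra hne
    obtain ⟨m, hm⟩ := exists_ne (0 : M)
    obtain ⟨m', rfl⟩ := h r hne m
    exact hm (hr0 m' trivial)
  rw [this, zero_sub] at hr
  obtain ⟨y, hy⟩ := Ideal.mem_span_singleton'.1 hr
  exact ⟨-y, by linear_combination -hy⟩

theorem isUnit_of_map_of_ker_isNilpotent {A : Type u} {R : Type v} [Ring A] [CommRing R]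
    {π : A →+* R} (hπ : Function.Surjective π) (hnil : ∀ a, π a = 0 → IsNilpotent a) {a : A}
    (ha : IsUnit (π a)) : IsUnit a := by
  obtain ⟨r, hr⟩ := ha.exists_right_inv
  obtain ⟨b, rfl⟩ := hπ r
  have h1 : IsUnit (a * b) := by
    simpa using (hnil (1 - a * b) (by simp [hr])).isUnit_one_sub
  have h2 : IsUnit (b * a) := by
    simpa using (hnil (1 - b * a) (by simp [mul_comm, hr])).isUnit_one_sub
  obtain ⟨c, hc⟩ := h1.exists_right_inv
  obtain ⟨d, hd⟩ := h2.exists_left_inv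
  exact isUnit_iff_exists_and_exists.2 ⟨⟨b * c, by rw [← mul_assoc, hc]⟩, ⟨d * b, by rw [mul_assoc, hd]⟩⟩

theorem ker_le_jacobson_of_isNilpotent {A : Type u} {R : Type v} [Ring A] [CommRing R]
    {π : A →+* R} (hnil : ∀ a, π a = 0 → IsNilpotent a) : RingHom.ker π ≤ Ring.jacobson A := by
  intro a ha
  rw [← Ideal.jacobson_bot, Ideal.mem_jacobson_iff]
  intro y
  have h1 : IsNilpotent (-(y * a)) := (hnil (y * a) (by
    rw [map_mul, (RingHom.mem_ker).1 ha, mul_zero])).neg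
  obtain ⟨z, hz⟩ := h1.isUnit_one_sub.exists_left_inv
  refine ⟨z, ?_⟩
  rw [Ideal.mem_bot, mul_assoc, ← hz]
  noncomm_ring

theorem isField_and_exists_mem_ker {A : Type u} [Ring A] [IsNoetherianRing A]
    (hD : IsRightDistributiveRing A) {R : Type v} [CommRing R] [IsDomain R] {π : A →+* R}
    (hπ : Function.Surjective π) (hnil : ∀ a, π a = 0 → IsNilpotent a)
    (hker : RingHom.ker π ≠ ⊥) :
    IsField R ∧ ∃ x, π x = 0 ∧ ∀ y u, π y = 0 → π u = 0 → x ≠ y * u := by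
  rw [isRightDistributiveRing_iff] at hD
  set N := RingHom.ker π with hN
  -- Nakayama: a nil ideal lies in the Jacobson radical, and `N` is a finitely generated left ideal.
  have htop : N • (⊤ : Submodule A N) ≠ ⊤ := by
    intro h
    have h1 : (⊤ : Submodule A N) = ⊥ := by
      refine Submodule.FG.eq_bot_of_le_jacobson_smul (IsNoetherian.noetherian _) ?_
      conv_lhs => rw [← h]
      exact Submodule.smul_mono_left (ker_le_jacobson_of_isNilpotent hnil)
    apply hker
    rw [eq_bot_iff]
    intro x hx
    have h2 : (⟨x, hx⟩ : N) ∈ (⊤ : Submodule A N) := trivial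
    rw [h1] at h2
    exact congrArg Subtype.val ((Submodule.mem_bot A).1 h2)
  constructor
  · let e : A ⧸ N ≃+* R := RingHom.quotientKerEquivOfSurjective hπ
    let _ : Module R (N ⧸ N • (⊤ : Submodule A N)) := Module.compHom _ e.symm.toRingHom
    have hsmul : ∀ (a : A) (m : N), π a • Submodule.Quotient.mk (p := N • (⊤ : Submodule A N)) m =
        Submodule.Quotient.mk (a • m) := by
      intro a m
      have h1 : e.symm (π a) = Ideal.Quotient.mk N a := by
        rw [RingEquiv.symm_apply_eq]; rfl
      change e.symm (π a) • Submodule.Quotient.mk (p := N • (⊤ : Submodule A N)) m = _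
      rw [h1]; rfl
    have hfin : Module.Finite R (N ⧸ N • (⊤ : Submodule A N)) := by
      obtain ⟨s, hs⟩ := (Module.Finite.fg_top : (⊤ : Submodule A (N ⧸ N • (⊤ : Submodule A N))).FG)
      refine ⟨⟨s, eq_top_iff.2 fun m _ => ?_⟩⟩
      have hm : m ∈ Submodule.span A (s : Set (N ⧸ N • (⊤ : Submodule A N))) := by
        rw [hs]; trivial
      induction hm using Submodule.span_induction with
      | mem x hx => exact Submodule.subset_span hx
      | zero => exact zero_mem _
      | add x y _ _ hx hy => exact add_mem (hx trivial) (hy trivial)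
      | smul a x _ hx =>
        obtain ⟨x, rfl⟩ := Submodule.Quotient.mk_surjective _ x
        rw [← Submodule.Quotient.mk_smul, ← hsmul]
        exact Submodule.smul_mem _ _ (hx trivial)
    have : Nontrivial (N ⧸ N • (⊤ : Submodule A N)) := Submodule.Quotient.nontrivial_iff.2 htop
    refine isField_of_divisible (M := N ⧸ N • (⊤ : Submodule A N)) fun r hr m => ?_
    obtain ⟨x, rfl⟩ := hπ r
    obtain ⟨⟨n, hn⟩, rfl⟩ := Submodule.Quotient.mk_surjective _ m
    have hn0 : π n = 0 := hn
    -- As `π x ≠ 0` in a domain, both `r` and `b` fall into `N`. Then `n = n * a + n * b = x * r + n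
    -- * b`, so `n` is divisible by `x` modulo `N²`.
    obtain ⟨a, b, hab, ⟨r, h1⟩, ⟨s, h2⟩⟩ := hD n x
    have hr0 : π r = 0 := by
      have h3 := congrArg π h1
      rw [map_mul, map_mul, hn0, zero_mul] at h3
      exact (mul_eq_zero.1 h3.symm).resolve_left hr
    have hb0 : π b = 0 := by
      have h3 := congrArg π h2
      rw [map_mul, map_mul, hn0, zero_mul] at h3
      exact (mul_eq_zero.1 h3).resolve_left hr
    refine ⟨Submodule.Quotient.mk ⟨r, hr0⟩, ?_⟩
    rw [hsmul, eq_comm, Submodule.Quotient.eq]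
    have h4 : (⟨n, hn⟩ : N) - x • ⟨r, hr0⟩ = n • ⟨b, hb0⟩ := Subtype.ext (by
      change n - x * r = n * b
      rw [← h1, sub_eq_iff_eq_add, ← mul_add, add_comm, hab, mul_one])
    rw [h4]
    exact Submodule.smul_mem_smul hn trivial
  · obtain ⟨x, hx⟩ : ∃ x, x ∉ N • (⊤ : Submodule A N) := by
      by_contra! h
      exact htop (eq_top_iff.2 fun x _ => h x)
    refine ⟨x, x.2, fun y u hy hu h => hx ?_⟩
    have h4 : x = y • (⟨u, hu⟩ : N) := Subtype.ext h
    rw [h4]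
    exact Submodule.smul_mem_smul hy trivial

end ResidueField

/-! ### Uniserial Artinian modules from a chain of powers -/

section Uniserial

/-- A submodule is determined by the set of `k < n` with `f k` in it, and membership persists as `k`
grows. Hence submodules are comparable and finite in number. -/
theorem isUniserialModule_and_isArtinian_of_chain {R : Type u} {M : Type v} [Ring R]
    [AddCommGroup M] [Module R M] (f : ℕ → M) (n : ℕ)
    (h : ∀ m : M, m ≠ 0 → ∃ k < n, (∃ r : R, m = r • f k) ∧ ∃ r : R, f k = r • m)
    (hf : ∀ k, ∃ r : R, f (k + 1) = r • f k) :
    IsUniserialModule R M ∧ IsArtinian R M := by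
  have hup : ∀ (X : Submodule R M) (k l : ℕ), k ≤ l → f k ∈ X → f l ∈ X := by
    intro X k l hkl hk
    induction l, hkl using Nat.le_induction with
    | base => exact hk
    | succ l _ ih =>
      obtain ⟨r, hr⟩ := hf l
      exact hr ▸ X.smul_mem r ih
  have hle : ∀ X Y : Submodule R M, (∀ k < n, f k ∈ X → f k ∈ Y) → X ≤ Y := by
    intro X Y hXY m hm
    by_cases hm0 : m = 0
    · rw [hm0]; exact zero_mem _
    obtain ⟨k, hk, ⟨r, hr⟩, ⟨s, hs⟩⟩ := h m hm0
    rw [hr]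
    exact Y.smul_mem r (hXY k hk (hs ▸ X.smul_mem s hm))
  constructor
  · intro X Y
    by_contra! hne
    obtain ⟨hX, hY⟩ := hne
    have hX' : ∃ k < n, f k ∈ X ∧ f k ∉ Y := by
      by_contra! hc; exact hX (hle X Y hc)
    have hY' : ∃ k < n, f k ∈ Y ∧ f k ∉ X := by
      by_contra! hc; exact hY (hle Y X hc)
    obtain ⟨k, -, hkX, hkY⟩ := hX'
    obtain ⟨l, -, hlY, hlX⟩ := hY'
    rcases le_total k l with hkl | hkl
    · exact hlX (hup X k l hkl hkX)
    · exact hkY (hup Y l k hkl hlY)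
  · have hinj : Function.Injective
        (fun X : Submodule R M => ({k : Fin n | f k ∈ X} : Set (Fin n))) := by
      intro X Y hXY
      have h1 : ∀ k < n, f k ∈ X ↔ f k ∈ Y := fun k hk => Set.ext_iff.1 hXY ⟨k, hk⟩
      exact le_antisymm (hle _ _ fun k hk => (h1 k hk).1) (hle _ _ fun k hk => (h1 k hk).2)
    have : Finite (Submodule R M) := Finite.of_injective _ hinj
    exact (inferInstance : WellFoundedLT (Submodule R M))

theorem exists_eq_mul_pow_of_not_isUnit {A : Type u} [Ring A] {x : A} {n : ℕ} (hx : x ^ n = 0)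
    (h : ∀ y, ¬ IsUnit y → ∃ u, y = u * x) {a : A} (ha : a ≠ 0) :
    ∃ k < n, ∃ u : A, IsUnit u ∧ a = u * x ^ k := by
  classical
  -- The required exponent is one less than the first `k` with `a ∉ A x ^ k`; a non-unit cofactor
  -- would supply another `x`.
  have hex : ∃ k, ¬ ∃ u, a = u * x ^ k := ⟨n, by rw [hx]; simpa using ha⟩
  set k := Nat.find hex with hk
  have hk1 : ¬ ∃ u, a = u * x ^ k := Nat.find_spec hex
  have hkn : k ≤ n := Nat.find_min' hex (by rw [hx]; simpa using ha)
  obtain ⟨m, hm⟩ : ∃ m, k = m + 1 := Nat.exists_eq_succ_of_ne_zero fun h0 =>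
    hk1 ⟨a, by rw [h0, pow_zero, mul_one]⟩
  obtain ⟨u, hu⟩ := not_not.1 (Nat.find_min hex (show m < k by omega))
  refine ⟨m, by omega, u, ?_, hu⟩
  by_contra hnu
  obtain ⟨v, rfl⟩ := h u hnu
  exact hk1 ⟨v, by rw [hu, hm, pow_succ', mul_assoc]⟩

theorem isUniserialModule_and_isArtinian_left {A : Type u} [Ring A] {x : A} {n : ℕ}
    (hx : x ^ n = 0) (h : ∀ y, ¬ IsUnit y → ∃ u, y = u * x) :
    IsUniserialModule A A ∧ IsArtinian A A := by
  refine isUniserialModule_and_isArtinian_of_chain (fun k => x ^ k) n (fun a ha => ?_)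
    fun k => ⟨x, pow_succ' x k⟩
  obtain ⟨k, hk, u, hu, rfl⟩ := exists_eq_mul_pow_of_not_isUnit hx h ha
  obtain ⟨v, hv⟩ := hu.exists_left_inv
  exact ⟨k, hk, ⟨u, rfl⟩, ⟨v, by rw [smul_eq_mul, ← mul_assoc, hv, one_mul]⟩⟩

theorem isUniserialModule_and_isArtinian_right {A : Type u} [Ring A] {x : A} {n : ℕ}
    (hx : x ^ n = 0) (h : ∀ y, ¬ IsUnit y → ∃ u, y = x * u) :
    IsUniserialModule Aᵐᵒᵖ A ∧ IsArtinian Aᵐᵒᵖ A := by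
  refine isUniserialModule_and_isArtinian_of_chain (fun k => x ^ k) n (fun a ha => ?_)
    fun k => ⟨.op x, pow_succ x k⟩
  have hx' : (MulOpposite.op x) ^ n = 0 := by rw [← MulOpposite.op_pow, hx]; rfl
  obtain ⟨k, hk, u, hu, hau⟩ := exists_eq_mul_pow_of_not_isUnit (A := Aᵐᵒᵖ) hx' (fun y hy => by
    obtain ⟨u, hu⟩ := h y.unop (fun hc => hy (isUnit_unop.1 hc))
    exact ⟨.op u, congrArg MulOpposite.op hu⟩) (a := .op a) (by simpa using ha)
  obtain ⟨v, hv⟩ := hu.exists_left_inv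
  refine ⟨k, hk, ⟨u, congrArg MulOpposite.unop hau⟩, ⟨v, ?_⟩⟩
  have h1 : v * MulOpposite.op a = (MulOpposite.op x) ^ k := by
    rw [hau, ← mul_assoc, hv, one_mul]
  exact (congrArg MulOpposite.unop h1).symm

end Uniserial

/-! ### The local case: a two-sided generator of the nil ideal -/

section Local

/-- If `b` is a unit, then `y ∈ xA` directly. Otherwise `a` is a unit and `x ∈ yA`; the cofactor
must be a unit because `x` is not a product of two elements of the kernel. -/
theorem exists_eq_mul_right_of_ne_mul {A : Type u} [Ring A] (hD : IsRightDistributiveRing A)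
    {R : Type v} [CommRing R] {π : A →+* R} (hF : IsField R)
    (hunit : ∀ a, π a ≠ 0 → IsUnit a) {x : A}
    (hx2 : ∀ y u, π y = 0 → π u = 0 → x ≠ y * u) {y : A} (hy : π y = 0) : ∃ u, y = x * u := by
  let _ := hF.toField
  obtain ⟨a, b, hab, ⟨r, hr⟩, ⟨s, hs⟩⟩ := isRightDistributiveRing_iff.1 hD x y
  by_cases hb : π b = 0
  · have ha : π a ≠ 0 := fun ha => one_ne_zero (α := R) (by
      rw [← map_one π, ← hab, map_add, ha, hb, add_zero])
    obtain ⟨c, hc⟩ := (hunit a ha).exists_right_inv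
    have h1 : x = y * (r * c) := by rw [← mul_assoc, ← hr, mul_assoc, hc, mul_one]
    have h2 : π (r * c) ≠ 0 := fun h0 => hx2 y _ hy h0 h1
    obtain ⟨d, hd⟩ := (hunit _ h2).exists_right_inv
    refine ⟨d, ?_⟩
    conv_rhs => rw [h1]
    rw [mul_assoc, hd, mul_one]
  · obtain ⟨c, hc⟩ := (hunit b hb).exists_right_inv
    exact ⟨s * c, by rw [← mul_assoc, ← hs, mul_assoc, hc, mul_one]⟩

/-- A nonzero central multiple of the last nonzero power of `x` forces conjugation by that power to
be trivial on the residue field. Thus `x * a ∈ Ax + x²A`, and iterating removes the error because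
`x` is nilpotent. -/
theorem exists_mul_eq_mul_of_isCentrallyEssential {A : Type u} [Ring A]
    (hC : IsCentrallyEssential A) {R : Type v} [CommRing R] {π : A →+* R} (hF : IsField R)
    (hunit : ∀ a, π a ≠ 0 → IsUnit a) {x : A} (hx : π x = 0) (hx0 : x ≠ 0) (hxn : IsNilpotent x)
    (hN : ∀ y, π y = 0 → ∃ u, y = x * u) (a : A) : ∃ b, x * a = b * x := by
  classical
  let _ := hF.toField
  obtain ⟨m, hm0, hm1⟩ : ∃ m, x ^ (m + 2) = 0 ∧ x ^ (m + 1) ≠ 0 := by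
    have h1 := Nat.find_spec hxn
    have h2 : ∀ k < Nat.find hxn, x ^ k ≠ 0 := fun k hk => Nat.find_min hxn hk
    have hA : Nontrivial A := ⟨x, 0, hx0⟩
    rcases h : Nat.find hxn with _ | _ | m
    · rw [h, pow_zero] at h1; exact absurd h1 one_ne_zero
    · rw [h, zero_add, pow_one] at h1; exact absurd h1 hx0
    · exact ⟨m, by rw [← h]; exact h1, h2 _ (by omega)⟩
  obtain ⟨u, -, hzc, hz0⟩ := hC.exists_mul_mem_center hm1
  have hu : π u ≠ 0 := by
    intro h0
    obtain ⟨v, rfl⟩ := hN u h0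
    rw [← mul_assoc, ← pow_succ, hm0, zero_mul] at hz0
    exact hz0 rfl
  have hann : ∀ w, x ^ (m + 1) * w = 0 → π w = 0 := by
    intro w hw
    by_contra h0
    obtain ⟨v, hv⟩ := (hunit w h0).exists_right_inv
    exact hm1 (by rw [← mul_one (x ^ (m + 1)), ← hv, ← mul_assoc, hw, zero_mul])
  have hswap : ∀ b, ∃ c, b * x = x * c := fun b => hN _ (by rw [map_mul, hx, mul_zero])
  -- The extra `b` records that the final `c` also satisfies `x * c ∈ Ax`.
  have hpow : ∀ (j : ℕ) (a : A), ∃ b c, b * x = x * c ∧ a * x ^ (j + 1) = x ^ (j + 1) * c := by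
    intro j a
    induction j with
    | zero =>
      obtain ⟨c, hc⟩ := hswap a
      exact ⟨a, c, hc, by simpa using hc⟩
    | succ j ih =>
      obtain ⟨_, b, -, hb⟩ := ih
      obtain ⟨c, hc⟩ := hswap b
      exact ⟨b, c, hc, by rw [pow_succ, ← mul_assoc, hb, mul_assoc, hc, mul_assoc]⟩
  have happrox : ∀ a, ∃ b c, x * a = b * x + x ^ 2 * c := by
    intro a
    obtain ⟨b, c, hbc, hc⟩ := hpow m a
    have h1 := Subring.mem_center_iff.1 hzc a
    rw [← mul_assoc, hc] at h1
    have h2 : π (c * u - u * a) = 0 := by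
      apply hann
      rw [mul_sub, ← mul_assoc, h1, ← mul_assoc, sub_self]
    have h3 : π (a - c) = 0 := by
      rw [map_sub, map_mul, map_mul, mul_comm, ← mul_sub, mul_eq_zero] at h2
      rw [map_sub, ← neg_sub, h2.resolve_left hu, neg_zero]
    obtain ⟨w, hw⟩ := hN _ h3
    refine ⟨b, w, ?_⟩
    rw [hbc, pow_two, mul_assoc, ← hw, mul_sub]; abel
  have hall : ∀ k, ∃ b c, x * a = b * x + x ^ (k + 1) * c := by
    intro k
    induction k with
    | zero => exact ⟨0, a, by simp⟩
    | succ k ih =>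
      obtain ⟨b, c, hbc⟩ := ih
      obtain ⟨b', c', h'⟩ := happrox c
      refine ⟨b + x ^ k * b', c', ?_⟩
      rw [hbc, pow_succ x k, mul_assoc, h']
      noncomm_ring
  obtain ⟨b, c, hbc⟩ := hall (m + 1)
  exact ⟨b, by rw [hbc, show m + 1 + 1 = m + 2 from rfl, hm0, zero_mul, add_zero]⟩

theorem isUniserialRing_and_isTwoSidedArtinianRing {A : Type u} [Ring A]
    (hD : IsRightDistributiveRing A) (hC : IsCentrallyEssential A)
    {R : Type v} [CommRing R] {π : A →+* R} (hF : IsField R)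
    (hunit : ∀ a, π a ≠ 0 → IsUnit a) (hnil : ∀ a, π a = 0 → IsNilpotent a)
    {x : A} (hx : π x = 0) (hx2 : ∀ y u, π y = 0 → π u = 0 → x ≠ y * u) :
    IsUniserialRing A ∧ IsTwoSidedArtinianRing A := by
  have hN : ∀ y, π y = 0 → ∃ u, y = x * u := fun y hy =>
    exists_eq_mul_right_of_ne_mul hD hF hunit hx2 hy
  have hx0 : x ≠ 0 := fun h => hx2 0 0 (map_zero π) (map_zero π) (by rw [h, mul_zero])
  obtain ⟨n, hn⟩ := hnil x hx
  have hπ : ∀ y, ¬ IsUnit y → π y = 0 := fun y hy => not_not.1 fun h => hy (hunit y h)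
  have hr := isUniserialModule_and_isArtinian_right hn fun y hy => hN y (hπ y hy)
  have hl := isUniserialModule_and_isArtinian_left hn fun y hy => by
    obtain ⟨u, rfl⟩ := hN y (hπ y hy)
    exact exists_mul_eq_mul_of_isCentrallyEssential hC hF hunit hx hx0 ⟨n, hn⟩ hN u
  exact ⟨⟨hl.1, hr.1⟩, ⟨hl.2, hr.2⟩⟩

end Local

/-! ### Indecomposable rings -/

section Indecomposable

theorem uniserial_or_dedekind_of_indecomposable {A : Type u} [Ring A] [Nontrivial A]
    [IsNoetherianRing A] (hD : IsRightDistributiveRing A) (hC : IsCentrallyEssential A)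
    (hI : ∀ e : A, IsIdempotentElem e → e = 0 ∨ e = 1) :
    (IsUniserialRing A ∧ IsTwoSidedArtinianRing A ∧ IsCentrallyEssential A) ∨
      IsCommDedekindDomain A := by
  obtain ⟨R, _, π, hπ, hR, hnil⟩ := exists_surjective_isReduced hD hC hI
  have hRn : Nontrivial R := by
    refine ⟨1, 0, fun h => ?_⟩
    obtain ⟨k, hk⟩ := hnil 1 (by rw [map_one, h])
    exact one_ne_zero ((one_pow k).symm.trans hk)
  have hRN : IsNoetherianRing R := isNoetherianRing_of_surjective A R π hπ
  have hRI : ∀ e : R, IsIdempotentElem e → e = 0 ∨ e = 1 := by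
    intro e he
    -- Idempotents lift modulo a nil kernel, so `R` is indecomposable too.
    obtain ⟨f, hf, rfl⟩ := exists_isIdempotentElem_eq_of_ker_isNilpotent π
      (fun x hx => hnil x hx) e (hπ e) he
    rcases hI f hf with rfl | rfl
    · exact Or.inl (map_zero π)
    · exact Or.inr (map_one π)
  have hRd : IsDomain R := isDomain_of_isReduced (hD.of_surjective π hπ) hRI
  by_cases hker : RingHom.ker π = ⊥
  · right
    have hinj : Function.Injective π := (RingHom.injective_iff_ker_eq_bot π).2 hker
    have hcomm : ∀ a b : A, a * b = b * a := fun a b => hinj (by rw [map_mul, map_mul, mul_comm])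
    refine ⟨hcomm, ?_⟩
    let _ : CommRing A := { (inferInstance : Ring A) with mul_comm := hcomm }
    have : IsDomain A := hinj.isDomain π
    exact isDedekindDomain_of_exists_add_eq_one (isRightDistributiveRing_iff.1 hD)
  · left
    obtain ⟨hF, x, hx, hx2⟩ := isField_and_exists_mem_ker hD hπ hnil hker
    let _ := hF.toField
    have hunit : ∀ a, π a ≠ 0 → IsUnit a := fun a ha =>
      isUnit_of_map_of_ker_isNilpotent hπ hnil (by
        obtain ⟨b, hb⟩ := hF.mul_inv_cancel ha
        exact IsUnit.of_mul_eq_one b hb)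
    have h := isUniserialRing_and_isTwoSidedArtinianRing hD hC hF hunit hnil hx hx2
    exact ⟨h.1, h.2, hC⟩

end Indecomposable

/-! ### Splitting off a central idempotent -/

section Corner

/-- The projection of a ring onto the corner of a central idempotent. -/
def cornerHom {A : Type u} [Ring A] {e : A} (he : IsIdempotentElem e)
    (hc : e ∈ Subring.center A) : A →+* he.Corner where
  toFun r := ⟨e * r * e, r, rfl⟩
  map_one' := Subtype.ext (show e * 1 * e = e by rw [mul_one, he.eq])
  map_zero' := Subtype.ext (show e * 0 * e = 0 by rw [mul_zero, zero_mul])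
  map_add' r s := Subtype.ext (show e * (r + s) * e = e * r * e + e * s * e by rw [mul_add, add_mul])
  map_mul' r s := Subtype.ext (by
    change e * (r * s) * e = e * r * e * (e * s * e)
    have h : ∀ g, e * g * e = e * g := fun g => by
      rw [mul_assoc, Subring.mem_center_iff.1 hc g, ← mul_assoc, he.eq]
    rw [h, h, h, mul_assoc e r, ← mul_assoc r e s, Subring.mem_center_iff.1 hc r]
    simp only [← mul_assoc, he.eq])

variable {A : Type u} [Ring A] {e : A} (he : IsIdempotentElem e) (hc : e ∈ Subring.center A)

theorem cornerHom_val (r : A) : (cornerHom he hc r).1 = e * r := by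
  change e * r * e = e * r
  rw [mul_assoc, Subring.mem_center_iff.1 hc r, ← mul_assoc, he.eq]

theorem mul_corner_val (r : he.Corner) : e * r.1 = r.1 :=
  ((Subsemigroup.mem_corner_iff he).1 r.2).1

theorem cornerHom_apply_val (r : he.Corner) : cornerHom he hc r.1 = r :=
  Subtype.ext (by rw [cornerHom_val, mul_corner_val])

theorem cornerHom_surjective : Function.Surjective (cornerHom he hc) :=
  fun r => ⟨r.1, cornerHom_apply_val he hc r⟩

theorem IsCentrallyEssential.corner (h : IsCentrallyEssential A) (he : IsIdempotentElem e) :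
    IsCentrallyEssential he.Corner := by
  have hc := h.mem_center_of_isIdempotentElem he
  intro a ha
  have ha' : a.1 ≠ 0 := fun h0 => ha (Subtype.ext h0)
  obtain ⟨c, hcc, hd, hd0⟩ := h.exists_mul_mem_center ha'
  have hm : ∀ z ∈ Subring.center A, cornerHom he hc z ∈ Subring.center he.Corner :=
    fun z hz => Subring.mem_center_iff.2 fun g => by
      rw [← cornerHom_apply_val he hc g, ← map_mul, ← map_mul, Subring.mem_center_iff.1 hz]
  have h1 : a * cornerHom he hc c = cornerHom he hc (a.1 * c) := by
    rw [map_mul, cornerHom_apply_val]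
  have h2 : cornerHom he hc (a.1 * c) ≠ 0 := by
    intro h0
    apply hd0
    have h3 := congrArg (Subtype.val) h0
    rw [cornerHom_val, ← mul_assoc, mul_corner_val] at h3
    exact h3
  exact ⟨_, hm c hcc, _, hm _ hd, fun h0 => h2 (by rw [← h1, h0, mul_zero]), h2, h1⟩

theorem nontrivial_corner (h0 : e ≠ 0) : Nontrivial he.Corner :=
  ⟨1, 0, fun h => h0 (congrArg Subtype.val h)⟩

theorem cornerHom_prod_bijective : Function.Bijective
    ((cornerHom he hc).prod (cornerHom he.one_sub (sub_mem (one_mem _) hc))) := by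
  constructor
  · rw [injective_iff_map_eq_zero]
    intro r hr
    have h1 := congrArg Subtype.val (congrArg Prod.fst hr)
    have h2 := congrArg Subtype.val (congrArg Prod.snd hr)
    rw [RingHom.prod_apply, cornerHom_val] at h1 h2
    have h3 : r = e * r + (1 - e) * r := by rw [← add_mul, add_sub_cancel, one_mul]
    rw [h3, h1, h2]
    exact add_zero 0
  · rintro ⟨r, s⟩
    have h1 : e * s.1 = 0 := by
      rw [← mul_corner_val he.one_sub s, ← mul_assoc, he.mul_one_sub_self, zero_mul]
    have h2 : (1 - e) * r.1 = 0 := by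
      rw [← mul_corner_val he r, ← mul_assoc, he.one_sub_mul_self, zero_mul]
    refine ⟨r.1 + s.1, Prod.ext (Subtype.ext ?_) (Subtype.ext ?_)⟩
    · rw [RingHom.prod_apply, cornerHom_val, mul_add, mul_corner_val, h1, add_zero]
    · rw [RingHom.prod_apply, cornerHom_val, mul_add, mul_corner_val, h2, zero_add]

end Corner

/-! ### Assembling finite products -/

section Product

theorem IsProductOfUniserialArtinianOrDedekind.of_factor {A : Type u} [Ring A] [Nontrivial A]
    (h : (IsUniserialRing A ∧ IsTwoSidedArtinianRing A ∧ IsCentrallyEssential A) ∨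
      IsCommDedekindDomain A) : IsProductOfUniserialArtinianOrDedekind A :=
  ⟨1, fun _ => A, fun _ => inferInstance, one_pos, fun _ => ⟨inferInstance, h⟩,
    ⟨RingEquiv.symm (RingEquiv.piUnique fun _ : Fin 1 => A)⟩⟩

theorem IsProductOfUniserialArtinianOrDedekind.of_prod {A B C : Type u} [Ring A] [Ring B] [Ring C]
    (hB : IsProductOfUniserialArtinianOrDedekind B)
    (hC : IsProductOfUniserialArtinianOrDedekind C) (f : A ≃+* B × C) :
    IsProductOfUniserialArtinianOrDedekind A := by
  obtain ⟨m, S, _, hm, hS, ⟨eB⟩⟩ := hB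
  obtain ⟨n, T, _, hn, hT, ⟨eC⟩⟩ := hC
  let U : Fin m ⊕ Fin n → Type u := Sum.elim S T
  let _ : ∀ s, Ring (U s) := fun s =>
    match s with
    | .inl i => (inferInstance : Ring (S i))
    | .inr j => (inferInstance : Ring (T j))
  have hU : ∀ s, Nontrivial (U s) ∧ ((IsUniserialRing (U s) ∧ IsTwoSidedArtinianRing (U s) ∧
      IsCentrallyEssential (U s)) ∨ IsCommDedekindDomain (U s)) := by
    rintro (i | j)
    · exact hS i
    · exact hT j
  let g : (∀ s, U s) ≃+* (∀ i, S i) × ∀ j, T j :=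
    { Equiv.sumPiEquivProdPi U with
      map_mul' := fun _ _ => rfl
      map_add' := fun _ _ => rfl }
  exact ⟨m + n, fun i => U (finSumFinEquiv.symm i), inferInstance, by omega, fun i => hU _,
    ⟨((f.trans (eB.prodCongr eC)).trans g.symm).trans
      (RingEquiv.piCongrLeft' U finSumFinEquiv)⟩⟩

/-- Noetherian induction on the kernel of a surjection splits off central idempotents. -/
theorem isProductOfUniserialArtinianOrDedekind_of_surjective {A : Type u} [Ring A]
    [IsNoetherianRing A] (I : Ideal A) : ∀ (B : Type u) [Ring B] [Nontrivial B] (f : A →+* B),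
      Function.Surjective f → RingHom.ker f = I → IsRightDistributiveRing B →
      IsCentrallyEssential B → IsProductOfUniserialArtinianOrDedekind B := by
  induction I using WellFoundedGT.induction with
  | ind I ih =>
    intro B _ _ f hf hI hD hC
    have : IsNoetherianRing B := isNoetherianRing_of_surjective A B f hf
    by_cases hidem : ∀ e : B, IsIdempotentElem e → e = 0 ∨ e = 1
    · exact .of_factor (uniserial_or_dedekind_of_indecomposable hD hC hidem)
    push Not at hidem
    obtain ⟨e, he, he0, he1⟩ := hidem
    have hc := hC.mem_center_of_isIdempotentElem he
    have key : ∀ (e : B) (he : IsIdempotentElem e) (hc : e ∈ Subring.center B), e ≠ 0 → e ≠ 1 →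
        IsProductOfUniserialArtinianOrDedekind he.Corner := by
      intro e he hc he0 he1
      have := nontrivial_corner he he0
      refine ih (RingHom.ker ((cornerHom he hc).comp f)) ?_ he.Corner ((cornerHom he hc).comp f)
        ((cornerHom_surjective he hc).comp hf) rfl
        (hD.of_surjective _ (cornerHom_surjective he hc)) (hC.corner he)
      rw [← hI]
      -- The kernel grows strictly: a preimage of `1 - e ≠ 0` dies in the corner but not in `B`.
      refine lt_of_le_of_ne (fun x hx => ?_) fun heq => he1 ?_
      · rw [RingHom.mem_ker, RingHom.comp_apply, (RingHom.mem_ker).1 hx, map_zero]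
      · obtain ⟨a, ha⟩ := hf (1 - e)
        have h1 : a ∈ RingHom.ker f := by
          rw [heq, RingHom.mem_ker, RingHom.comp_apply, ha]
          exact Subtype.ext (by rw [cornerHom_val, he.mul_one_sub_self]; rfl)
        rw [RingHom.mem_ker, ha, sub_eq_zero] at h1
        exact h1.symm
    exact .of_prod (key e he hc he0 he1)
      (key (1 - e) he.one_sub (sub_mem (one_mem _) hc) (sub_ne_zero.2 he1.symm)
        fun h => he0 (by simpa using h))
      (RingEquiv.ofBijective _ (cornerHom_prod_bijective he hc))

theorem IsCommDedekindDomain.isDistributiveRing_and_isTwoSidedNoetherianRing {A : Type u} [Ring A]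
    (h : IsCommDedekindDomain A) : IsDistributiveRing A ∧ IsTwoSidedNoetherianRing A := by
  obtain ⟨hcomm, h⟩ := h
  let _ : CommRing A := { (inferInstance : Ring A) with mul_comm := hcomm }
  have hd : IsDedekindDomain A := h
  have hr : IsRightDistributiveRing A :=
    isRightDistributiveRing_iff.2 IsDedekindDomain.exists_add_eq_one
  have hn : IsNoetherianRing A := inferInstance
  refine ⟨⟨?_, hr⟩, hn, isRightNoetherianRing_iff.2 ?_⟩
  · rw [isLeftDistributiveRing_iff]
    intro x y
    obtain ⟨a, b, hab, ⟨r, h1⟩, ⟨s, h2⟩⟩ := isRightDistributiveRing_iff.1 hr x y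
    exact ⟨a, b, hab, ⟨r, by rw [hcomm, h1, hcomm]⟩, ⟨s, by rw [hcomm, h2, hcomm]⟩⟩
  · exact isNoetherianRing_of_ringEquiv A (RingEquiv.toOpposite A)

theorem IsProductOfUniserialArtinianOrDedekind.isDistributiveRing_and {A : Type u} [Ring A]
    (h : IsProductOfUniserialArtinianOrDedekind A) :
    IsDistributiveRing A ∧ IsTwoSidedNoetherianRing A ∧ IsCentrallyEssential A := by
  obtain ⟨n, B, _, -, hB, ⟨f⟩⟩ := h
  have key : ∀ i, IsDistributiveRing (B i) ∧ IsTwoSidedNoetherianRing (B i) ∧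
      IsCentrallyEssential (B i) := by
    intro i
    have := (hB i).1
    rcases (hB i).2 with ⟨hu, ha, hc⟩ | hd
    · exact ⟨⟨hu.1.isDistributiveModule, hu.2.isDistributiveModule⟩,
        ha.isTwoSidedNoetherianRing, hc⟩
    · have h1 := hd.isDistributiveRing_and_isTwoSidedNoetherianRing
      exact ⟨h1.1, h1.2, isCentrallyEssential_of_comm hd.1⟩
  refine ⟨⟨?_, ?_⟩, ?_, ?_⟩
  · exact (IsLeftDistributiveRing.pi fun i => (key i).1.1).of_surjective f.symm.toRingHom
      f.symm.surjective
  · exact (IsRightDistributiveRing.pi fun i => (key i).1.2).of_surjective f.symm.toRingHom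
      f.symm.surjective
  · exact (IsTwoSidedNoetherianRing.pi fun i => (key i).2.1).of_ringEquiv f.symm
  · exact (IsCentrallyEssential.pi fun i => (key i).2.2).of_ringEquiv f.symm

end Product

theorem proposition2p8 (A : Type u) [Ring A] [Nontrivial A] :
    ((IsRightDistributiveRing A ∧ IsLeftNoetherianRing A ∧ IsCentrallyEssential A) ↔
      IsProductOfUniserialArtinianOrDedekind A) ∧
    (IsProductOfUniserialArtinianOrDedekind A →
      IsDistributiveRing A ∧ IsTwoSidedNoetherianRing A) := by
  refine ⟨⟨fun ⟨hD, hN, hC⟩ => ?_, fun h => ?_⟩, fun h => ?_⟩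
  · have : IsNoetherianRing A := hN
    exact isProductOfUniserialArtinianOrDedekind_of_surjective _ A (RingHom.id A)
      Function.surjective_id rfl hD hC
  · obtain ⟨hD, hN, hC⟩ := h.isDistributiveRing_and
    exact ⟨hD.2, hN.1, hC⟩
  · obtain ⟨hD, hN, -⟩ := h.isDistributiveRing_and
    exact ⟨hD, hN⟩
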